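/- Let $\Gamma$ be a metrized graph, i.e. a finite connected graph, possibly with multiple edges and self-loops, in which every edge $e_i$ is a segment of length $L_i>0$. Let $V(\Gamma)$ and $E(\Gamma)$ be its vertex and edge sets, and let $v=|V(\Gamma)|\ge 4$. View $\Gamma$ (or any connected graph with edge lengths) as an electric circuit in which the resistance of each edge is its length. Let $j_z(x,y)$ be the voltage difference between $x$ and $z$ when unit current enters at $y$ and exits at $z$, let $r(x,y)=j_y(x,x)$ be the effective resistance, and let $$Kf(\Gamma)=\frac12\sum_{p,q\in V(\Gamma)}r(p,q)$$ be the Kirchhoff index. For an edge $e_i$ with end points $p_i,q_i$, let $\overline{\Gamma}_i$ be the metrized graph obtained from $\Gamma$ by contracting $e_i$ (so that $p_i$ and $q_i$ are identified), and let $\Gamma-e_i$ be the graph obtained by deleting the interior of $e_i$. If $\Gamma-e_i$ is connected, let $\hat{j}$ be its voltage function, let $R_i$ be the effective resistance between $p_i$ and $q_i$ in $\Gamma-e_i$, and for a vertex $p$ put $R_{a_i,p}=\hat{j}_{p_i}(p,q_i)$ and $R_{b_i,p}=\hat{j}_{q_i}(p,p_i)$. If $\Gamma-e_i$ is not connected,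 put $R_{a_i,p}=0$, $R_{b_i,p}=R_i$ when $p$ lies in the component of $p_i$ in $\Gamma-e_i$, and $R_{a_i,p}=R_i$, $R_{b_i,p}=0$ when $p$ lies in the component of $q_i$; every expression containing $R_i$ is then understood as its limit as $R_i\to\infty$. For a vertex $p\in V(\Gamma)$ let $$y(\Gamma)=\frac14\sum_{e_i\in E(\Gamma)}\frac{L_iR_i^2}{(L_i+R_i)^2}+\frac34\sum_{e_i\in E(\Gamma)}\frac{L_i(R_{a_i,p}-R_{b_i,p})^2}{(L_i+R_i)^2}.$$ Then, for every choice of the vertex $p$ in the definition of $y(\Gamma)$, $$(v-4)\,Kf(\Gamma)=\sum_{e_i\in E(\Gamma)}\frac{R_i}{L_i+R_i}\,Kf(\overline{\Gamma}_i)-v\cdot y(\Gamma).$$ -/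

import Mathlib

open Filter

/-- A multigraph with vertex type `V` and edge type `E` (parallel edges and self-loops allowed),
each edge `e` being a segment of length `len e > 0`, parametrized from `src e` to `tgt e`.
It need not be connected. -/
structure LengthGraph (V : Type*) (E : Type*) where
  src : E → V
  tgt : E → V
  len : E → ℝ
  len_pos : ∀ e, 0 < len e

namespace LengthGraph

variable {V E : Type*}

/-- The simple graph in which two distinct vertices are adjacent when some edge joins them. -/
def toSimpleGraph (G : LengthGraph V E) : SimpleGraph V :=
  SimpleGraph.fromRel fun x y => ∃ e, G.src e = x ∧ G.tgt e = y

/-- `x` and `y` lie in the same connected component. -/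
def Reachable (G : LengthGraph V E) (x y : V) : Prop :=
  G.toSimpleGraph.Reachable x y

def Connected (G : LengthGraph V E) : Prop :=
  G.toSimpleGraph.Connected

/-- Deletion of the interior of the edge `e`; all vertices are kept. -/
def deleteEdge (G : LengthGraph V E) (e : E) : LengthGraph V {j : E // j ≠ e} where
  src j := G.src j
  tgt j := G.tgt j
  len j := G.len j
  len_pos j := G.len_pos j

/-- The vertices left when the edge `e` is contracted: its two end points are identified. -/
def ContractVertex (G : LengthGraph V E) (e : E) :=
  Quot fun x y : V => x = G.src e ∧ y = G.tgt e

instance (G : LengthGraph V E) (e : E) [Finite V] : Finite (G.ContractVertex e) :=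
  inferInstanceAs (Finite (Quot _))

noncomputable instance (G : LengthGraph V E) (e : E) [Fintype V] :
    Fintype (G.ContractVertex e) :=
  Fintype.ofFinite _

noncomputable instance (G : LengthGraph V E) (e : E) : DecidableEq (G.ContractVertex e) :=
  Classical.decEq _

/-- Contraction of the edge `e`. -/
def contractEdge (G : LengthGraph V E) (e : E) :
    LengthGraph (G.ContractVertex e) {j : E // j ≠ e} where
  src j := Quot.mk _ (G.src j)
  tgt j := Quot.mk _ (G.tgt j)
  len j := G.len j
  len_pos j := G.len_pos j

theorem Connected.contractEdge {G : LengthGraph V E} (hG : G.Connected) (e : E) :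
    (G.contractEdge e).Connected := by
  have hp := hG.preconnected
  obtain ⟨x₀⟩ := hG.nonempty
  have key : ∀ i : E, (G.contractEdge e).toSimpleGraph.Reachable
      (Quot.mk _ (G.src i)) (Quot.mk _ (G.tgt i)) := by
    intro i
    by_cases hi : i = e
    · subst hi
      have h : (Quot.mk _ (G.src i) : G.ContractVertex i) = Quot.mk _ (G.tgt i) :=
        Quot.sound ⟨rfl, rfl⟩
      exact h ▸ SimpleGraph.Reachable.refl _
    · by_cases hne : (Quot.mk _ (G.src i) : G.ContractVertex e) = Quot.mk _ (G.tgt i)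
      · exact hne ▸ SimpleGraph.Reachable.refl _
      · exact SimpleGraph.Adj.reachable
          ((SimpleGraph.fromRel_adj _ _ _).2 ⟨hne, Or.inl ⟨⟨i, hi⟩, rfl, rfl⟩⟩)
  have walk : ∀ a b : V, G.toSimpleGraph.Walk a b →
      (G.contractEdge e).toSimpleGraph.Reachable (Quot.mk _ a) (Quot.mk _ b) := by
    intro a b w
    induction w with
    | nil => exact SimpleGraph.Reachable.refl _
    | cons h _ ih =>
      obtain ⟨_, ⟨i, rfl, rfl⟩ | ⟨i, rfl, rfl⟩⟩ := (SimpleGraph.fromRel_adj _ _ _).1 h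
      · exact (key i).trans ih
      · exact (key i).symm.trans ih
  refine (SimpleGraph.connected_iff _).2 ⟨?_, ⟨Quot.mk _ x₀⟩⟩
  rintro ⟨a⟩ ⟨b⟩
  exact (hp a b).elim (walk a b)

section Voltage

variable [Fintype V] [Fintype E] [DecidableEq V]

/-- The total current that flows out of `x` along the edges under the potential `f`, when the
resistance of every edge is its length. -/
noncomputable def outflow (G : LengthGraph V E) (f : V → ℝ) (x : V) : ℝ :=
  ∑ e : E, ((if G.src e = x then (f (G.src e) - f (G.tgt e)) / G.len e else 0) +
    (if G.tgt e = x then (f (G.tgt e) - f (G.src e)) / G.len e else 0))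

/-- `f` is the potential, with reference voltage `0` at `z`, when unit current enters at `y`
and exits at `z`. -/
def IsPotential (G : LengthGraph V E) (z y : V) (f : V → ℝ) : Prop :=
  f z = 0 ∧ ∀ x, G.outflow f x = (if x = y then 1 else 0) - (if x = z then 1 else 0)

/-- The voltage function `j_z(x, y)`: the voltage difference between `x` and `z` when unit
current enters at `y` and exits at `z`. On a connected graph the potential exists and is unique,
see `existsUnique_isPotential`. -/
noncomputable def voltage (G : LengthGraph V E) (z x y : V) : ℝ :=
  Classical.epsilon (G.IsPotential z y) x

/-- The effective resistance `r(x, y) = j_y(x, x)`. -/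
noncomputable def resistance (G : LengthGraph V E) (x y : V) : ℝ :=
  G.voltage y x x

theorem sum_outflow_mul (G : LengthGraph V E) (f g : V → ℝ) :
    ∑ x, G.outflow f x * g x =
      ∑ e, (f (G.src e) - f (G.tgt e)) * (g (G.src e) - g (G.tgt e)) / G.len e := by
  simp only [outflow, Finset.sum_mul]
  rw [Finset.sum_comm]
  refine Finset.sum_congr rfl fun e _ => ?_
  simp only [add_mul, ite_mul, zero_mul, Finset.sum_add_distrib, Finset.sum_ite_eq,
    Finset.mem_univ, if_true]
  ring

theorem eq_of_outflow_eq_zero {G : LengthGraph V E} (hG : G.Connected) {f : V → ℝ}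
    (hf : ∀ x, G.outflow f x = 0) (a b : V) : f a = f b := by
  have h0 : ∑ e, (f (G.src e) - f (G.tgt e)) * (f (G.src e) - f (G.tgt e)) / G.len e = 0 := by
    rw [← sum_outflow_mul]; simp [hf]
  have h1 : ∀ e, f (G.src e) = f (G.tgt e) := by
    intro e
    have h2 := (Finset.sum_eq_zero_iff_of_nonneg
      (fun e _ => div_nonneg (mul_self_nonneg _) (G.len_pos e).le)).1 h0 e (Finset.mem_univ e)
    have h3 := (div_eq_zero_iff.1 h2).resolve_right (G.len_pos e).ne'
    exact sub_eq_zero.1 (mul_self_eq_zero.1 h3)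
  have walk : ∀ a b : V, G.toSimpleGraph.Walk a b → f a = f b := by
    intro a b w
    induction w with
    | nil => rfl
    | cons h _ ih =>
      obtain ⟨_, ⟨i, rfl, rfl⟩ | ⟨i, rfl, rfl⟩⟩ := (SimpleGraph.fromRel_adj _ _ _).1 h
      · exact (h1 i).trans ih
      · exact (h1 i).symm.trans ih
  exact (hG.preconnected a b).elim (walk a b)

/-- `outflow` as a linear map, grounded at `z`. -/
noncomputable def groundedOutflow (G : LengthGraph V E) (z : V) : (V → ℝ) →ₗ[ℝ] (V → ℝ) where
  toFun f x := G.outflow f x + if x = z then f z else 0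
  map_add' f g := by
    funext x
    simp only [outflow, Pi.add_apply]
    rw [add_add_add_comm, ← Finset.sum_add_distrib]
    congr 1
    · refine Finset.sum_congr rfl fun e _ => ?_
      split_ifs <;> ring
    · split_ifs <;> ring
  map_smul' c f := by
    funext x
    simp only [outflow, Pi.smul_apply, smul_eq_mul, RingHom.id_apply, mul_add, Finset.mul_sum]
    congr 1
    · refine Finset.sum_congr rfl fun e _ => ?_
      split_ifs <;> ring
    · split_ifs <;> ring

theorem sum_outflow (G : LengthGraph V E) (f : V → ℝ) : ∑ x, G.outflow f x = 0 := by
  simpa using G.sum_outflow_mul f fun _ => 1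

theorem existsUnique_isPotential {G : LengthGraph V E} (hG : G.Connected) (z y : V) :
    ∃! f, G.IsPotential z y f := by
  have inj : Function.Injective (G.groundedOutflow z) := by
    rw [← LinearMap.ker_eq_bot, LinearMap.ker_eq_bot']
    intro f hf
    have h : ∀ x, G.outflow f x + (if x = z then f z else 0) = 0 := fun x => congrFun hf x
    have hz : f z = 0 := by
      have := Finset.sum_congr rfl fun x (_ : x ∈ Finset.univ) => h x
      simpa [Finset.sum_add_distrib, sum_outflow] using this
    have h' : ∀ x, G.outflow f x = 0 := by simpa [hz] using h
    funext x
    rw [eq_of_outflow_eq_zero hG h' x z, hz, Pi.zero_apply]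
  obtain ⟨f, hf⟩ := (LinearMap.injective_iff_surjective.1 inj)
    fun x => (if x = y then 1 else 0) - (if x = z then 1 else 0)
  have h : ∀ x, G.outflow f x + (if x = z then f z else 0) =
      (if x = y then 1 else 0) - (if x = z then 1 else 0) := fun x => congrFun hf x
  have hz : f z = 0 := by
    have := Finset.sum_congr rfl fun x (_ : x ∈ Finset.univ) => h x
    simpa [Finset.sum_add_distrib, sum_outflow] using this
  refine ⟨f, ⟨hz, by simpa [hz] using h⟩, ?_⟩
  rintro g ⟨hgz, hg⟩
  apply inj
  rw [hf]
  funext x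
  change G.outflow g x + (if x = z then g z else 0) = _
  rw [hgz, hg]
  simp

end Voltage

end LengthGraph

/-- A metrized graph with a chosen vertex set `V` and edge set `E` (both finite where it is
used): a connected graph, possibly with parallel edges and self-loops, whose edges are
parametrized segments of positive length. -/
structure MetrizedGraph (V : Type*) (E : Type*) extends LengthGraph V E where
  connected : toLengthGraph.Connected

namespace MetrizedGraph

variable {V E : Type*}

/-- The metrized graph `Γ̄_e` obtained by contracting the edge `e`. -/
def contract (Γ : MetrizedGraph V E) (e : E) :
    MetrizedGraph (Γ.ContractVertex e) {j : E // j ≠ e} where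
  toLengthGraph := Γ.contractEdge e
  connected := Γ.connected.contractEdge e

/-- The edge `e` is a bridge: deleting its interior disconnects the graph. -/
def IsBridge (Γ : MetrizedGraph V E) (e : E) : Prop :=
  ¬ (Γ.deleteEdge e).Connected

variable [Fintype V] [Fintype E] [DecidableEq V]

/-- The Kirchhoff index. -/
noncomputable def kirchhoffIndex (Γ : MetrizedGraph V E) : ℝ :=
  (1 / 2) * ∑ p : V, ∑ q : V, Γ.resistance p q

variable [DecidableEq E]

open Classical in
/-- The value of an expression `F R_e`. If `e` is not a bridge, then `R_e` is the resistance
between the end points of `e` after the interior of `e` is deleted; if `e` is a bridge, then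
the limit as `R_e → ∞` is meant. -/
noncomputable def evalR (Γ : MetrizedGraph V E) (e : E) (F : ℝ → ℝ) : ℝ :=
  if Γ.IsBridge e then limUnder atTop F
  else F ((Γ.deleteEdge e).resistance (Γ.src e) (Γ.tgt e))

open Classical in
/-- `R_{a_e,p}` as an expression in `R = R_e`. If `e` is not a bridge it is the voltage
`j_{src e}(p, tgt e)` in the graph with the interior of `e` deleted; if `e` is a bridge, it is
`0` when `p` is on the side of `src e`, and `R` when `p` is on the side of `tgt e`. -/
noncomputable def Ra (Γ : MetrizedGraph V E) (e : E) (p : V) (R : ℝ) : ℝ :=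
  if Γ.IsBridge e then (if (Γ.deleteEdge e).Reachable (Γ.src e) p then 0 else R)
  else (Γ.deleteEdge e).voltage (Γ.src e) p (Γ.tgt e)

open Classical in
/-- `R_{b_e,p}` as an expression in `R = R_e`, with the roles of the end points exchanged. -/
noncomputable def Rb (Γ : MetrizedGraph V E) (e : E) (p : V) (R : ℝ) : ℝ :=
  if Γ.IsBridge e then (if (Γ.deleteEdge e).Reachable (Γ.tgt e) p then 0 else R)
  else (Γ.deleteEdge e).voltage (Γ.tgt e) p (Γ.src e)

/-- The invariant `y(Γ)`, computed with the base vertex `p`. -/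
noncomputable def y (Γ : MetrizedGraph V E) (p : V) : ℝ :=
  (1 / 4) * ∑ e : E, Γ.evalR e (fun R => Γ.len e * R ^ 2 / (Γ.len e + R) ^ 2) +
  (3 / 4) * ∑ e : E, Γ.evalR e
    (fun R => Γ.len e * (Γ.Ra e p R - Γ.Rb e p R) ^ 2 / (Γ.len e + R) ^ 2)

end MetrizedGraph

/-! Everything is rewritten in resistances of Γ itself. With r_e the resistance between the ends of
e, the circuit laws give R/(L+R) = r_e/L_e, and y(Γ) becomes S/4 + 3T/4, where S = ∑ r_e²/L_e and T
is the Dirichlet energy of r(p,·); bridges fit, with r_e = L_e. Contracting e lowers r(x,y) by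
d²/r_e, where d is the drop along e of the unit flow from x to y (`resistance_contractEdge`,
`voltage_reciprocity`). Multiply by r_e/L_e and sum over e. By Foster's theorem the main term gives
(v-1) Kf; since ∑ d²/L_e is the energy of the flow, hence r(x,y), the correction costs Kf. The
merged vertex has been counted twice. Removing the excess involves r_e (r(x,s)+r(x,t))/L_e, with s,
t the ends of e, and its sum over e is known from the Laplacian of r(x,·) (`dirichlet_resistance`).
This costs 2 Kf and returns v(S+3T)/4 = v·y(Γ), which leaves (v-4) Kf + v·y(Γ). -/

namespace LengthGraph

/-! ### Dirichlet form, voltages and resistances -/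

section Dirichlet

variable {V E : Type*} [Fintype E]

/-- The Dirichlet form of the network. -/
noncomputable def dirichlet (G : LengthGraph V E) (f φ : V → ℝ) : ℝ :=
  ∑ e, (f (G.src e) - f (G.tgt e)) * (φ (G.src e) - φ (G.tgt e)) / G.len e

theorem dirichlet_comm (G : LengthGraph V E) (f φ : V → ℝ) :
    G.dirichlet f φ = G.dirichlet φ f :=
  Finset.sum_congr rfl fun _ _ => by ring

theorem dirichlet_add_smul (G : LengthGraph V E) (f h φ : V → ℝ) (c : ℝ) :
    G.dirichlet (fun x => f x + c * h x) φ = G.dirichlet f φ + c * G.dirichlet h φ := by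
  simp only [dirichlet, Finset.mul_sum, ← Finset.sum_add_distrib]
  exact Finset.sum_congr rfl fun _ _ => by ring

variable [Fintype V] [DecidableEq V]

theorem dirichlet_single (G : LengthGraph V E) (f : V → ℝ) (x : V) :
    G.dirichlet f (fun w => if w = x then 1 else 0) = G.outflow f x := by
  have h := G.sum_outflow_mul f (fun w => if w = x then 1 else 0)
  simp only [mul_ite, mul_one, mul_zero, Finset.sum_ite_eq', Finset.mem_univ, if_true] at h
  exact h.symm

/-- A potential is determined, up to its value at the sink, by its Dirichlet pairings. -/
theorem voltage_eq_of_dirichlet {G : LengthGraph V E} (hG : G.Connected) {z y : V} {f : V → ℝ}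
    (hf : ∀ φ, G.dirichlet f φ = φ y - φ z) (x : V) : G.voltage z x y = f x - f z := by
  obtain ⟨h, hh, huniq⟩ := existsUnique_isPotential hG z y
  have h1 : G.IsPotential z y (Classical.epsilon (G.IsPotential z y)) :=
    Classical.epsilon_spec ⟨h, hh⟩
  have h2 : G.IsPotential z y (fun x => f x - f z) := by
    refine ⟨sub_self _, fun w => ?_⟩
    rw [← dirichlet_single]
    have := hf (fun v => if v = w then 1 else 0)
    simp only [eq_comm (a := w), ← this, dirichlet, sub_sub_sub_cancel_right]
  rw [voltage, huniq _ h1, ← huniq _ h2]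

theorem dirichlet_voltage {G : LengthGraph V E} (hG : G.Connected) (z y : V) (φ : V → ℝ) :
    G.dirichlet (fun x => G.voltage z x y) φ = φ y - φ z := by
  have h1 : G.IsPotential z y (Classical.epsilon (G.IsPotential z y)) :=
    Classical.epsilon_spec (existsUnique_isPotential hG z y).exists
  change G.dirichlet (Classical.epsilon (G.IsPotential z y)) φ = _
  rw [dirichlet, ← sum_outflow_mul]
  simp [h1.2, sub_mul]

theorem voltage_self {G : LengthGraph V E} (hG : G.Connected) (z y : V) :
    G.voltage z z y = 0 :=
  (Classical.epsilon_spec (existsUnique_isPotential hG z y).exists :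
    G.IsPotential z y (Classical.epsilon (G.IsPotential z y))).1

/-- Both sides are the Dirichlet pairing of the two potentials grounded at z. -/
theorem voltage_symm {G : LengthGraph V E} (hG : G.Connected) (z x y : V) :
    G.voltage z x y = G.voltage z y x := by
  have h := G.dirichlet_comm (fun w => G.voltage z w y) (fun w => G.voltage z w x)
  simp only [dirichlet_voltage hG, voltage_self hG, sub_zero] at h
  exact h.symm

/-- Superposition: the flow from y to z is the flow from y to o minus the flow from z to o. -/
theorem voltage_change_base {G : LengthGraph V E} (hG : G.Connected) (o z x y : V) :
    G.voltage z x y =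
      G.voltage o x y - G.voltage o x z - G.voltage o z y + G.voltage o z z := by
  have h : ∀ φ : V → ℝ,
      G.dirichlet (fun x => G.voltage o x y + (-1) * G.voltage o x z) φ = φ y - φ z := by
    intro φ
    rw [dirichlet_add_smul, dirichlet_voltage hG, dirichlet_voltage hG]
    ring
  rw [voltage_eq_of_dirichlet hG h]
  ring

theorem resistance_eq_voltage {G : LengthGraph V E} (hG : G.Connected) (o x y : V) :
    G.resistance x y = G.voltage o x x - 2 * G.voltage o x y + G.voltage o y y := by
  rw [resistance, voltage_change_base hG o y x x, voltage_symm hG o y x]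
  ring

theorem resistance_comm {G : LengthGraph V E} (hG : G.Connected) (x y : V) :
    G.resistance x y = G.resistance y x := by
  rw [resistance_eq_voltage hG x, resistance_eq_voltage hG x y x, voltage_symm hG x x y]
  ring

theorem resistance_self {G : LengthGraph V E} (hG : G.Connected) (x : V) :
    G.resistance x x = 0 :=
  voltage_self hG x x

theorem two_mul_voltage {G : LengthGraph V E} (hG : G.Connected) (z x y : V) :
    2 * G.voltage z x y = G.resistance x z + G.resistance y z - G.resistance x y := by
  rw [resistance_eq_voltage hG z x z, resistance_eq_voltage hG z y z,
    resistance_eq_voltage hG z x y, voltage_symm hG z x z, voltage_symm hG z y z]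
  simp only [voltage_self hG]
  ring

/-- The energy of the unit flow between two vertices is their effective resistance. -/
theorem sum_sq_voltage_sub {G : LengthGraph V E} (hG : G.Connected) (y x : V) :
    ∑ e, (G.voltage y (G.src e) x - G.voltage y (G.tgt e) x) ^ 2 / G.len e =
      G.resistance x y := by
  have h := dirichlet_voltage hG y x (fun w => G.voltage y w x)
  rw [voltage_self hG, sub_zero] at h
  rw [resistance, ← h, dirichlet]
  exact Finset.sum_congr rfl fun _ _ => by ring

theorem resistance_nonneg {G : LengthGraph V E} (hG : G.Connected) (x y : V) :
    0 ≤ G.resistance x y := by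
  rw [← sum_sq_voltage_sub hG]
  exact Finset.sum_nonneg fun e _ => div_nonneg (sq_nonneg _) (G.len_pos e).le

theorem resistance_ne_zero {G : LengthGraph V E} (hG : G.Connected) {x y : V} (hxy : x ≠ y) :
    G.resistance x y ≠ 0 := by
  intro h
  rw [← sum_sq_voltage_sub hG, Finset.sum_eq_zero_iff_of_nonneg
    (fun e _ => div_nonneg (sq_nonneg _) (G.len_pos e).le)] at h
  -- Zero energy forces every drop to vanish, yet pairing with the indicator of x must detect the
  -- unit current entering there.
  have h0 := dirichlet_voltage hG y x (fun w => if w = x then 1 else 0)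
  rw [dirichlet, Finset.sum_eq_zero] at h0
  · simp [hxy.symm] at h0
  · intro e he
    have h3 := (div_eq_zero_iff.1 (h e he)).resolve_right (G.len_pos e).ne'
    rw [pow_eq_zero_iff two_ne_zero] at h3
    rw [h3, zero_mul, zero_div]

/-- Reciprocity: a unit flow from `x` to `y` makes the same voltage drop between `s` and `t` as
a unit flow from `s` to `t` makes between `x` and `y`. -/
theorem voltage_reciprocity {G : LengthGraph V E} (hG : G.Connected) (x y s t : V) :
    G.voltage y s x - G.voltage y t x = G.voltage t x s - G.voltage t y s := by
  rw [voltage_change_base hG y t x s, voltage_change_base hG y t y s, voltage_self hG y s,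
    voltage_self hG y t, voltage_symm hG y s x, voltage_symm hG y t x]
  ring

/-- The Laplacian of the resistance to a fixed vertex, in weak form. -/
theorem dirichlet_resistance {G : LengthGraph V E} (hG : G.Connected) (x : V) (φ : V → ℝ) :
    G.dirichlet (G.resistance x) φ = 2 * ∑ y, φ y -
      ∑ e, G.resistance (G.src e) (G.tgt e) / G.len e * (φ (G.src e) + φ (G.tgt e)) -
      2 * φ x := by
  -- Grounded at x, r(x,w) is the diagonal value j_x(w,w). The Laplacian of j_x(·,y) is evaluated at
  -- y itself, where it equals 1 - [x = y]; weighting by φ y and summing gives the identity.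
  have key : ∑ e, (φ (G.src e) * (G.voltage x (G.src e) (G.src e) -
        G.voltage x (G.tgt e) (G.src e)) - φ (G.tgt e) * (G.voltage x (G.src e) (G.tgt e) -
        G.voltage x (G.tgt e) (G.tgt e))) / G.len e = ∑ y, φ y - φ x := by
    have h : ∀ y, φ y * G.dirichlet (fun w => G.voltage x w y) (fun w => if w = y then 1 else 0) =
        φ y - φ y * (if x = y then 1 else 0) := by
      intro y
      rw [dirichlet_voltage hG, if_pos rfl, mul_sub, mul_one]
    have h' := Finset.sum_congr rfl fun y (_ : y ∈ Finset.univ) => h y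
    rw [Finset.sum_sub_distrib] at h'
    simp only [mul_ite, mul_one, mul_zero, Finset.sum_ite_eq, Finset.mem_univ, if_true] at h'
    rw [← h']
    simp only [dirichlet, Finset.mul_sum]
    rw [Finset.sum_comm]
    refine Finset.sum_congr rfl fun e _ => ?_
    have : ∀ y, φ y * ((G.voltage x (G.src e) y - G.voltage x (G.tgt e) y) *
        ((if G.src e = y then 1 else 0) - (if G.tgt e = y then 1 else 0)) / G.len e) =
        (if G.src e = y then
          φ y * (G.voltage x (G.src e) y - G.voltage x (G.tgt e) y) / G.len e else 0) -
        (if G.tgt e = y then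
          φ y * (G.voltage x (G.src e) y - G.voltage x (G.tgt e) y) / G.len e else 0) := by
      intro y
      split_ifs <;> ring
    simp only [this, Finset.sum_sub_distrib, Finset.sum_ite_eq, Finset.mem_univ, if_true]
    ring
  have h2 : 2 * ∑ y, φ y - 2 * φ x = 2 * (∑ y, φ y - φ x) := by ring
  rw [sub_right_comm, h2, ← key, Finset.mul_sum, ← Finset.sum_sub_distrib, dirichlet]
  refine Finset.sum_congr rfl fun e _ => ?_
  rw [resistance_eq_voltage hG x x (G.src e), resistance_eq_voltage hG x x (G.tgt e),
    resistance_eq_voltage hG x (G.src e) (G.tgt e), voltage_symm hG x (G.tgt e) (G.src e)]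
  simp only [voltage_self hG]
  ring

/-- Foster's theorem. -/
theorem sum_resistance_div_len {G : LengthGraph V E} (hG : G.Connected) :
    ∑ e, G.resistance (G.src e) (G.tgt e) / G.len e = (Fintype.card V : ℝ) - 1 := by
  obtain ⟨x⟩ := hG.nonempty
  -- The constant test function makes the Dirichlet pairing vanish.
  have h := dirichlet_resistance hG x (fun _ => 1)
  simp only [dirichlet, sub_self, mul_zero, zero_div, Finset.sum_const_zero, Finset.sum_const,
    Finset.card_univ, nsmul_eq_mul, mul_one, ← Finset.sum_mul] at h
  linarith

theorem dirichlet_resistance_resistance {G : LengthGraph V E} (hG : G.Connected) (x y : V) :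
    G.dirichlet (G.resistance x) (G.resistance x) =
      G.dirichlet (G.resistance y) (G.resistance y) := by
  -- The pairing of r(x,·) with r(y,·) can be computed with either Laplacian; only the point terms 2
  -- r(x,y) and 2 r(y,x) depend on the pair jointly, and they cancel.
  have h := G.dirichlet_comm (G.resistance x) (G.resistance y)
  have hx := dirichlet_resistance hG x (G.resistance x)
  have hy := dirichlet_resistance hG y (G.resistance y)
  rw [dirichlet_resistance hG x, dirichlet_resistance hG y, resistance_comm hG x y] at h
  rw [resistance_self hG] at hx hy
  linarith

end Dirichlet

/-! ### Contraction of an edge -/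

section Contract

variable {V E : Type*}

/-- The image of a vertex in the contraction of the edge `e`. -/
def contractMk (G : LengthGraph V E) (e : E) (x : V) : G.ContractVertex e :=
  Quot.mk _ x

theorem contractMk_src (G : LengthGraph V E) (e : E) :
    G.contractMk e (G.src e) = G.contractMk e (G.tgt e) :=
  Quot.sound ⟨rfl, rfl⟩

theorem sum_contractVertex [Fintype V] [DecidableEq V] (G : LengthGraph V E) {e : E}
    (he : G.src e ≠ G.tgt e) (φ : G.ContractVertex e → ℝ) :
    ∑ a, φ a = ∑ x, φ (G.contractMk e x) - φ (G.contractMk e (G.src e)) := by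
  rw [contractMk_src, ← Finset.sum_erase_eq_sub (Finset.mem_univ (G.tgt e))]
  -- Choosing the source to represent the merged class shows that the quotient map is injective off
  -- the target.
  let ψ : G.ContractVertex e → V := Quot.lift (fun w => if w = G.tgt e then G.src e else w) (by
    rintro a b ⟨rfl, rfl⟩
    simp [he])
  have hψ : ∀ w, ψ (G.contractMk e w) = if w = G.tgt e then G.src e else w := fun _ => rfl
  symm
  refine Finset.sum_bij (fun x _ => G.contractMk e x) (fun _ _ => Finset.mem_univ _) ?_ ?_
    (fun _ _ => rfl)
  · intro a ha b hb hab
    have h := congrArg ψ hab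
    rwa [hψ, hψ, if_neg (Finset.mem_erase.1 ha).1, if_neg (Finset.mem_erase.1 hb).1] at h
  · rintro ⟨b⟩ -
    by_cases hb : b = G.tgt e
    · exact ⟨G.src e, by simp [he], by rw [contractMk_src, hb]; rfl⟩
    · exact ⟨b, by simp [hb], rfl⟩

variable [Fintype E] [DecidableEq E]

theorem dirichlet_eq_add_deleteEdge (G : LengthGraph V E) (e : E) (f φ : V → ℝ) :
    G.dirichlet f φ = (f (G.src e) - f (G.tgt e)) * (φ (G.src e) - φ (G.tgt e)) / G.len e +
      (G.deleteEdge e).dirichlet f φ :=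
  Fintype.sum_eq_add_sum_subtype_ne _ e

variable [Fintype V] [DecidableEq V]

/-- Superpose on the flow from x to y a flow from t to s that equalizes the potentials of the ends.
The result descends to the quotient, where the added source and sink coincide and cancel. -/
theorem resistance_contractEdge {G : LengthGraph V E} (hG : G.Connected) {e : E}
    (he : G.src e ≠ G.tgt e) (x y : V) :
    (G.contractEdge e).resistance (G.contractMk e x) (G.contractMk e y) = G.resistance x y -
      (G.voltage (G.tgt e) x (G.src e) - G.voltage (G.tgt e) y (G.src e)) ^ 2 /
        G.resistance (G.src e) (G.tgt e) := by
  set s := G.src e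
  set t := G.tgt e
  -- The multiple of the s–t potential that makes F agree at s and t.
  set c := (G.voltage t x s - G.voltage t y s) / G.resistance s t with hc
  let F : V → ℝ := fun w => G.voltage y w x + (-c) * G.voltage t w s
  have hr : G.voltage t s s = G.resistance s t := rfl
  have hF : F s = F t := by
    have h1 := voltage_reciprocity hG x y s t
    have h2 : c * G.resistance s t = G.voltage t x s - G.voltage t y s :=
      div_mul_cancel₀ _ (resistance_ne_zero hG he)
    simp only [F, voltage_self hG t s, hr]
    linarith
  let Fbar : G.ContractVertex e → ℝ := Quot.lift F (by
    rintro a b ⟨rfl, rfl⟩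
    exact hF)
  have hm : G.contractMk e s = G.contractMk e t := G.contractMk_src e
  have key : ∀ φ : G.ContractVertex e → ℝ, (G.contractEdge e).dirichlet Fbar φ =
      φ (G.contractMk e x) - φ (G.contractMk e y) := by
    intro φ
    have h1 := G.dirichlet_eq_add_deleteEdge e F (fun w => φ (G.contractMk e w))
    have hF' : F (G.src e) - F (G.tgt e) = 0 := sub_eq_zero.2 hF
    rw [hF', zero_mul, zero_div, zero_add] at h1
    have h2 : (G.contractEdge e).dirichlet Fbar φ =
      (G.deleteEdge e).dirichlet F (fun w => φ (G.contractMk e w)) := rfl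
    rw [h2, ← h1, dirichlet_add_smul, dirichlet_voltage hG, dirichlet_voltage hG, hm]
    ring
  have h := voltage_eq_of_dirichlet (hG.contractEdge e) key (G.contractMk e x)
  refine h.trans ?_
  change G.voltage y x x + (-c) * G.voltage t x s - (G.voltage y y x + (-c) * G.voltage t y s) = _
  rw [voltage_self hG, resistance, hc]
  ring

end Contract

/-! ### Deletion of an edge -/

section Delete

variable {V E : Type*}

theorem reachable_of_edge (G : LengthGraph V E) (i : E) : G.Reachable (G.src i) (G.tgt i) := by
  by_cases h : G.src i = G.tgt i
  · rw [h]; exact SimpleGraph.Reachable.refl _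
  · exact SimpleGraph.Adj.reachable ((SimpleGraph.fromRel_adj _ _ _).2 ⟨h, Or.inl ⟨i, rfl, rfl⟩⟩)

theorem Connected.induction {G : LengthGraph V E} (hG : G.Connected) {P : V → Prop}
    (h : ∀ i, P (G.src i) ↔ P (G.tgt i)) {x : V} (hx : P x) (y : V) : P y := by
  have walk : ∀ a b : V, G.toSimpleGraph.Walk a b → (P a ↔ P b) := by
    intro a b w
    induction w with
    | nil => rfl
    | cons hadj _ ih =>
      obtain ⟨_, ⟨i, rfl, rfl⟩ | ⟨i, rfl, rfl⟩⟩ := (SimpleGraph.fromRel_adj _ _ _).1 hadj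
      · exact (h i).trans ih
      · exact (h i).symm.trans ih
  exact (hG.preconnected x y).elim fun w => (walk x y w).1 hx

theorem reachable_src_iff_tgt (G : LengthGraph V E) (x : V) (i : E) :
    G.Reachable x (G.src i) ↔ G.Reachable x (G.tgt i) :=
  ⟨fun h => h.trans (G.reachable_of_edge i), fun h => h.trans (G.reachable_of_edge i).symm⟩

theorem Connected.reachable_deleteEdge {G : LengthGraph V E} (hG : G.Connected) (e : E) (x : V) :
    (G.deleteEdge e).Reachable (G.src e) x ∨ (G.deleteEdge e).Reachable (G.tgt e) x := by
  refine hG.induction (P := fun x => (G.deleteEdge e).Reachable (G.src e) x ∨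
    (G.deleteEdge e).Reachable (G.tgt e) x) (fun i => ?_)
    (Or.inl (SimpleGraph.Reachable.refl (G.src e))) x
  by_cases hi : i = e
  · subst hi
    exact iff_of_true (Or.inl (SimpleGraph.Reachable.refl _))
      (Or.inr (SimpleGraph.Reachable.refl _))
  · exact or_congr ((G.deleteEdge e).reachable_src_iff_tgt _ ⟨i, hi⟩)
      ((G.deleteEdge e).reachable_src_iff_tgt _ ⟨i, hi⟩)

theorem Connected.connected_deleteEdge {G : LengthGraph V E} (hG : G.Connected) {e : E}
    (h : (G.deleteEdge e).Reachable (G.src e) (G.tgt e)) : (G.deleteEdge e).Connected := by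
  have h' : ∀ x, (G.deleteEdge e).Reachable (G.src e) x := fun x =>
    (hG.reachable_deleteEdge e x).elim id fun hx => h.trans hx
  exact (SimpleGraph.connected_iff _).2 ⟨fun a b => (h' a).symm.trans (h' b), ⟨G.src e⟩⟩

variable [Fintype V] [Fintype E] [DecidableEq V] [DecidableEq E]

/-- Current divider: e is in parallel with the rest, which carries the fraction L/(L+R) of the unit
current. -/
theorem voltage_of_connected_deleteEdge {G : LengthGraph V E} (hG : G.Connected) {e : E}
    (he : (G.deleteEdge e).Connected) (x : V) :
    G.voltage (G.src e) x (G.tgt e) = (G.deleteEdge e).voltage (G.src e) x (G.tgt e) *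
      (G.len e / (G.len e + (G.deleteEdge e).resistance (G.src e) (G.tgt e))) := by
  set R := (G.deleteEdge e).resistance (G.src e) (G.tgt e) with hR
  have hL := G.len_pos e
  have hLR : G.len e + R ≠ 0 := (add_pos_of_pos_of_nonneg hL (resistance_nonneg he _ _)).ne'
  have hRt : (G.deleteEdge e).voltage (G.src e) (G.tgt e) (G.tgt e) = R := by
    rw [hR, resistance_comm he, resistance]
  have h : ∀ φ, G.dirichlet (fun w => 0 + (G.len e / (G.len e + R)) *
      (G.deleteEdge e).voltage (G.src e) w (G.tgt e)) φ = φ (G.tgt e) - φ (G.src e) := by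
    intro φ
    rw [dirichlet_add_smul, dirichlet_eq_add_deleteEdge G e (fun w => _),
      dirichlet_eq_add_deleteEdge G e (fun w => _), dirichlet_voltage he, voltage_self he, hRt]
    simp only [dirichlet, sub_self, zero_mul, zero_div, Finset.sum_const_zero]
    field_simp
    ring
  rw [voltage_eq_of_dirichlet hG h, voltage_self he]
  ring

-- All the current crosses the bridge, so the potential is constant on each side and drops by L
-- across it.
open Classical in
theorem voltage_of_not_connected_deleteEdge {G : LengthGraph V E} (hG : G.Connected) {e : E}
    (he : ¬ (G.deleteEdge e).Connected) (x : V) :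
    G.voltage (G.src e) x (G.tgt e) =
      if (G.deleteEdge e).Reachable (G.src e) x then 0 else G.len e := by
  have ht : ¬ (G.deleteEdge e).Reachable (G.src e) (G.tgt e) :=
    fun h => he (hG.connected_deleteEdge h)
  have hs : (G.deleteEdge e).Reachable (G.src e) (G.src e) := SimpleGraph.Reachable.refl _
  have h : ∀ φ, G.dirichlet (fun w => if (G.deleteEdge e).Reachable (G.src e) w then 0
      else G.len e) φ = φ (G.tgt e) - φ (G.src e) := by
    intro φ
    rw [dirichlet_eq_add_deleteEdge G e, if_pos hs, if_neg ht, dirichlet, Finset.sum_eq_zero]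
    · have := (G.len_pos e).ne'
      field_simp
      ring
    · intro i _
      simp only [(G.deleteEdge e).reachable_src_iff_tgt (G.src e) i, sub_self, zero_mul, zero_div]
  rw [voltage_eq_of_dirichlet hG h, if_pos hs, sub_zero]

end Delete

end LengthGraph

/-! ### From R_i to resistances in Γ -/

namespace MetrizedGraph

open LengthGraph Topology

variable {V E : Type*}

theorem tendsto_div_add_atTop (L : ℝ) : Tendsto (fun R : ℝ => R / (L + R)) atTop (𝓝 1) := by
  have h1 : Tendsto (fun R : ℝ => L / (L + R)) atTop (𝓝 0) :=
    tendsto_const_nhds.div_atTop (tendsto_atTop_add_const_left _ L tendsto_id)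
  have h2 : Tendsto (fun R : ℝ => 1 - L / (L + R)) atTop (𝓝 1) := by
    simpa using tendsto_const_nhds.sub h1
  refine h2.congr' ?_
  filter_upwards [eventually_gt_atTop (-L)] with R hR
  have : L + R ≠ 0 := by linarith
  field_simp
  ring

theorem tendsto_mul_sq_div_add_sq_atTop (L : ℝ) :
    Tendsto (fun R : ℝ => L * R ^ 2 / (L + R) ^ 2) atTop (𝓝 L) := by
  have h := ((tendsto_div_add_atTop L).pow 2).const_mul L
  simpa [div_pow, mul_div_assoc] using h

theorem tgt_not_reachable (Γ : MetrizedGraph V E) {e : E} (he : Γ.IsBridge e) :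
    ¬ (Γ.deleteEdge e).Reachable (Γ.src e) (Γ.tgt e) :=
  fun h => he (Γ.connected.connected_deleteEdge h)

variable [Fintype V] [Fintype E] [DecidableEq V] [DecidableEq E]

theorem resistance_of_isBridge (Γ : MetrizedGraph V E) {e : E} (he : Γ.IsBridge e) :
    Γ.resistance (Γ.src e) (Γ.tgt e) = Γ.len e := by
  rw [resistance_comm Γ.connected, resistance,
    voltage_of_not_connected_deleteEdge Γ.connected he, if_neg (Γ.tgt_not_reachable he)]

theorem resistance_of_not_isBridge (Γ : MetrizedGraph V E) {e : E} (he : ¬ Γ.IsBridge e) :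
    Γ.resistance (Γ.src e) (Γ.tgt e) = (Γ.deleteEdge e).resistance (Γ.src e) (Γ.tgt e) *
      (Γ.len e / (Γ.len e + (Γ.deleteEdge e).resistance (Γ.src e) (Γ.tgt e))) := by
  have he' : (Γ.deleteEdge e).Connected := not_not.1 he
  rw [resistance_comm Γ.connected, resistance, voltage_of_connected_deleteEdge Γ.connected he',
    resistance_comm he' (Γ.src e), resistance]

theorem len_add_resistance_ne_zero (Γ : MetrizedGraph V E) {e : E} (he : ¬ Γ.IsBridge e) :
    Γ.len e + (Γ.deleteEdge e).resistance (Γ.src e) (Γ.tgt e) ≠ 0 :=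
  (add_pos_of_pos_of_nonneg (Γ.len_pos e) (resistance_nonneg (not_not.1 he) _ _)).ne'

theorem evalR_div (Γ : MetrizedGraph V E) (e : E) :
    Γ.evalR e (fun R => R / (Γ.len e + R)) = Γ.resistance (Γ.src e) (Γ.tgt e) / Γ.len e := by
  have hL := (Γ.len_pos e).ne'
  unfold evalR
  split_ifs with he
  · rw [(tendsto_div_add_atTop _).limUnder_eq, Γ.resistance_of_isBridge he, div_self hL]
  · have := Γ.len_add_resistance_ne_zero he
    rw [Γ.resistance_of_not_isBridge he]
    field_simp

theorem evalR_sq (Γ : MetrizedGraph V E) (e : E) :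
    Γ.evalR e (fun R => Γ.len e * R ^ 2 / (Γ.len e + R) ^ 2) =
      Γ.resistance (Γ.src e) (Γ.tgt e) ^ 2 / Γ.len e := by
  have hL := (Γ.len_pos e).ne'
  unfold evalR
  split_ifs with he
  · rw [(tendsto_mul_sq_div_add_sq_atTop _).limUnder_eq, Γ.resistance_of_isBridge he]
    field_simp
  · have := Γ.len_add_resistance_ne_zero he
    rw [Γ.resistance_of_not_isBridge he]
    field_simp

theorem evalR_sub_sq (Γ : MetrizedGraph V E) (e : E) (p : V) :
    Γ.evalR e (fun R => Γ.len e * (Γ.Ra e p R - Γ.Rb e p R) ^ 2 / (Γ.len e + R) ^ 2) =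
      (Γ.resistance p (Γ.src e) - Γ.resistance p (Γ.tgt e)) ^ 2 / Γ.len e := by
  have hL := (Γ.len_pos e).ne'
  have hdiff : Γ.resistance p (Γ.src e) - Γ.resistance p (Γ.tgt e) =
      2 * Γ.voltage (Γ.src e) p (Γ.tgt e) - Γ.resistance (Γ.src e) (Γ.tgt e) := by
    rw [two_mul_voltage Γ.connected, resistance_comm Γ.connected (Γ.tgt e)]
    ring
  rw [hdiff]
  by_cases he : Γ.IsBridge e
  -- The two values are 0 and R in some order, so only the sign of the difference depends on p.
  · have hab : ∀ R, (Γ.Ra e p R - Γ.Rb e p R) ^ 2 = R ^ 2 := by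
      intro R
      simp only [Ra, Rb, if_pos he]
      by_cases hp : (Γ.deleteEdge e).Reachable (Γ.src e) p
      · have hp' : ¬ (Γ.deleteEdge e).Reachable (Γ.tgt e) p :=
          fun h => Γ.tgt_not_reachable he (hp.trans h.symm)
        simp [hp, hp']
      · simp [hp, (Γ.connected.reachable_deleteEdge e p).resolve_left hp]
    simp only [hab]
    rw [evalR, if_pos he, (tendsto_mul_sq_div_add_sq_atTop _).limUnder_eq,
      Γ.resistance_of_isBridge he, voltage_of_not_connected_deleteEdge Γ.connected he]
    split_ifs
    · field_simp
      ring
    · field_simp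
      ring
  · have hLR := Γ.len_add_resistance_ne_zero he
    have he' : (Γ.deleteEdge e).Connected := not_not.1 he
    have h1 := two_mul_voltage he' (Γ.src e) p (Γ.tgt e)
    have h2 := two_mul_voltage he' (Γ.tgt e) p (Γ.src e)
    rw [resistance_comm he' (Γ.tgt e) (Γ.src e)] at h1
    -- In Γ - e the two voltages add up to R, so their difference is 2 R_a - R.
    have hab : (Γ.deleteEdge e).voltage (Γ.tgt e) p (Γ.src e) =
        (Γ.deleteEdge e).resistance (Γ.src e) (Γ.tgt e) -
          (Γ.deleteEdge e).voltage (Γ.src e) p (Γ.tgt e) := by linarith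
    rw [evalR, if_neg he, Ra, Rb, if_neg he, if_neg he, hab, Γ.resistance_of_not_isBridge he,
      voltage_of_connected_deleteEdge Γ.connected he']
    field_simp
    ring

/-- The invariant `y` in terms of resistances in the graph itself. -/
theorem y_eq (Γ : MetrizedGraph V E) (p : V) :
    Γ.y p = (1 / 4) * ∑ e, Γ.resistance (Γ.src e) (Γ.tgt e) ^ 2 / Γ.len e +
      (3 / 4) * Γ.dirichlet (Γ.resistance p) (Γ.resistance p) := by
  simp only [y, evalR_sq, evalR_sub_sq, dirichlet]
  simp only [sq]

/-! ### Kirchhoff indices of contractions -/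

/-- Multiplying by r_e clears the denominator of the contraction formula, so that self-loops, where
r_e = 0, are covered too. The last sum removes the double count of the merged vertex. -/
theorem resistance_mul_kirchhoffIndex_contract (Γ : MetrizedGraph V E) (e : E) :
    Γ.resistance (Γ.src e) (Γ.tgt e) * (Γ.contract e).kirchhoffIndex =
      Γ.resistance (Γ.src e) (Γ.tgt e) * Γ.kirchhoffIndex -
      (1 / 2) * ∑ x, ∑ y, (Γ.voltage y (Γ.src e) x - Γ.voltage y (Γ.tgt e) x) ^ 2 -
      (1 / 4) * ∑ x, (2 * (Γ.resistance (Γ.src e) (Γ.tgt e) *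
          (Γ.resistance x (Γ.src e) + Γ.resistance x (Γ.tgt e))) -
        (Γ.resistance x (Γ.src e) - Γ.resistance x (Γ.tgt e)) ^ 2 -
        Γ.resistance (Γ.src e) (Γ.tgt e) ^ 2) := by
  have hG := Γ.connected
  by_cases he : Γ.src e = Γ.tgt e
  · simp [he, resistance_self hG]
  set r := Γ.resistance (Γ.src e) (Γ.tgt e) with hr
  have hr0 : r ≠ 0 := resistance_ne_zero hG he
  have hbar : ∀ x y, r * (Γ.contractEdge e).resistance (Γ.contractMk e x) (Γ.contractMk e y) =
      r * Γ.resistance x y - (Γ.voltage y (Γ.src e) x - Γ.voltage y (Γ.tgt e) x) ^ 2 := by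
    intro x y
    rw [resistance_contractEdge hG he, voltage_reciprocity hG x y, mul_sub, ← hr,
      mul_div_cancel₀ _ hr0]
  have hsrc : ∀ x, r * (Γ.contractEdge e).resistance (Γ.contractMk e x) (Γ.contractMk e (Γ.src e)) =
      (1 / 4) * (2 * (r * (Γ.resistance x (Γ.src e) + Γ.resistance x (Γ.tgt e))) -
        (Γ.resistance x (Γ.src e) - Γ.resistance x (Γ.tgt e)) ^ 2 - r ^ 2) := by
    intro x
    have h := two_mul_voltage hG (Γ.src e) (Γ.tgt e) x
    rw [resistance_comm hG (Γ.tgt e), ← hr, resistance_comm hG (Γ.tgt e)] at h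
    have h' : Γ.voltage (Γ.src e) (Γ.tgt e) x =
      (r + Γ.resistance x (Γ.src e) - Γ.resistance x (Γ.tgt e)) / 2 := by linarith
    rw [hbar, voltage_self hG, h']
    ring
  -- A double sum over V counts the merged class twice in each variable; the excess is two single
  -- sums, as its resistance to itself is 0.
  have hK : (Γ.contract e).kirchhoffIndex =
      (1 / 2) * ∑ x, ∑ y, (Γ.contractEdge e).resistance (Γ.contractMk e x) (Γ.contractMk e y) -
      ∑ x, (Γ.contractEdge e).resistance (Γ.contractMk e x) (Γ.contractMk e (Γ.src e)) := by
    have hc := hG.contractEdge e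
    change (1 / 2) * ∑ a, ∑ b, (Γ.contractEdge e).resistance a b = _
    rw [Γ.sum_contractVertex he]
    simp only [Γ.sum_contractVertex he, Finset.sum_sub_distrib]
    simp only [resistance_comm hc (Γ.contractMk e (Γ.src e)), resistance_self hc]
    ring
  have h1 : r * ∑ x, ∑ y, (Γ.contractEdge e).resistance (Γ.contractMk e x) (Γ.contractMk e y) =
      r * ∑ x, ∑ y, Γ.resistance x y -
        ∑ x, ∑ y, (Γ.voltage y (Γ.src e) x - Γ.voltage y (Γ.tgt e) x) ^ 2 := by
    simp only [Finset.mul_sum, hbar, Finset.sum_sub_distrib]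
  have h2 := Finset.sum_congr rfl fun x (_ : x ∈ Finset.univ) => hsrc x
  rw [← Finset.mul_sum, ← Finset.mul_sum] at h2
  rw [hK, mul_sub, mul_left_comm, h1, h2, kirchhoffIndex]
  ring

/-- The weighted sum of the Kirchhoff indices of all contractions. -/
theorem sum_evalR_mul_kirchhoffIndex_contract (Γ : MetrizedGraph V E) (p : V) :
    ∑ e, Γ.evalR e (fun R => R / (Γ.len e + R)) * (Γ.contract e).kirchhoffIndex =
      ((Fintype.card V : ℝ) - 4) * Γ.kirchhoffIndex + (Fintype.card V : ℝ) *
        ((1 / 4) * ∑ e, Γ.resistance (Γ.src e) (Γ.tgt e) ^ 2 / Γ.len e +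
          (3 / 4) * Γ.dirichlet (Γ.resistance p) (Γ.resistance p)) := by
  have hG := Γ.connected
  set T := Γ.dirichlet (Γ.resistance p) (Γ.resistance p) with hT
  set S := ∑ e, Γ.resistance (Γ.src e) (Γ.tgt e) ^ 2 / Γ.len e with hS
  have hterm : ∀ e, Γ.evalR e (fun R => R / (Γ.len e + R)) * (Γ.contract e).kirchhoffIndex =
      Γ.resistance (Γ.src e) (Γ.tgt e) / Γ.len e * Γ.kirchhoffIndex -
      (1 / 2) * ∑ x, ∑ y, (Γ.voltage y (Γ.src e) x - Γ.voltage y (Γ.tgt e) x) ^ 2 / Γ.len e -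
      (1 / 4) * ∑ x, (2 * (Γ.resistance (Γ.src e) (Γ.tgt e) / Γ.len e *
          (Γ.resistance x (Γ.src e) + Γ.resistance x (Γ.tgt e))) -
        (Γ.resistance x (Γ.src e) - Γ.resistance x (Γ.tgt e)) *
          (Γ.resistance x (Γ.src e) - Γ.resistance x (Γ.tgt e)) / Γ.len e -
        Γ.resistance (Γ.src e) (Γ.tgt e) ^ 2 / Γ.len e) := by
    intro e
    rw [evalR_div, div_mul_eq_mul_div, resistance_mul_kirchhoffIndex_contract, sub_div, sub_div,
      mul_div_assoc, mul_div_assoc, mul_div_assoc, Finset.sum_div, Finset.sum_div]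
    simp only [Finset.sum_div]
    congr 1
    · ring
    · exact congrArg _ (Finset.sum_congr rfl fun x _ => by ring)
  -- The Laplacian of r(x,·), tested on r(x,·), turns the first term into 4 ∑ r(x,y) - 2T; the
  -- square supplies the third T, which does not depend on the base vertex.
  have hx : ∀ x, ∑ e, (2 * (Γ.resistance (Γ.src e) (Γ.tgt e) / Γ.len e *
          (Γ.resistance x (Γ.src e) + Γ.resistance x (Γ.tgt e))) -
        (Γ.resistance x (Γ.src e) - Γ.resistance x (Γ.tgt e)) *
          (Γ.resistance x (Γ.src e) - Γ.resistance x (Γ.tgt e)) / Γ.len e -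
        Γ.resistance (Γ.src e) (Γ.tgt e) ^ 2 / Γ.len e) =
      4 * ∑ y, Γ.resistance x y - 3 * T - S := by
    intro x
    have h := dirichlet_resistance hG x (Γ.resistance x)
    rw [resistance_self hG] at h
    have h' := dirichlet_resistance_resistance hG x p
    rw [Finset.sum_sub_distrib, Finset.sum_sub_distrib, ← Finset.mul_sum]
    change 2 * _ - Γ.dirichlet (Γ.resistance x) (Γ.resistance x) - S = _
    linarith
  -- For each pair x, y the sum over edges is the energy of the unit flow, namely r(x,y).
  have henergy : ∑ e, ∑ x, ∑ y,
      (Γ.voltage y (Γ.src e) x - Γ.voltage y (Γ.tgt e) x) ^ 2 / Γ.len e =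
      2 * Γ.kirchhoffIndex := by
    rw [Finset.sum_comm, kirchhoffIndex, ← mul_assoc, mul_one_div_cancel two_ne_zero, one_mul]
    refine Finset.sum_congr rfl fun x _ => ?_
    rw [Finset.sum_comm]
    exact Finset.sum_congr rfl fun y _ => sum_sq_voltage_sub hG y x
  simp only [hterm, Finset.sum_sub_distrib (s := (Finset.univ : Finset E)), ← Finset.mul_sum,
    ← Finset.sum_mul, sum_resistance_div_len hG, henergy]
  rw [Finset.sum_comm]
  simp only [hx, Finset.sum_sub_distrib, ← Finset.mul_sum, Finset.sum_const, Finset.card_univ,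
    nsmul_eq_mul, kirchhoffIndex]
  ring

end MetrizedGraph

theorem mainTheorem1 {V E : Type*} [Fintype V] [DecidableEq V] [Fintype E] [DecidableEq E]
    (Γ : MetrizedGraph V E) (hv : 4 ≤ Fintype.card V) (p : V) :
    ((Fintype.card V : ℝ) - 4) * Γ.kirchhoffIndex =
      (∑ e : E, Γ.evalR e (fun R => R / (Γ.len e + R)) * (Γ.contract e).kirchhoffIndex) -
        (Fintype.card V : ℝ) * Γ.y p := by
  rw [Γ.sum_evalR_mul_kirchhoffIndex_contract p, Γ.y_eq]
  ring
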